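/- A state in $\mathbb{C}^{a}\otimes\mathbb{C}^{b}$ is a unit vector, and a product state is a state of the form $|x\rangle\otimes|y\rangle$. A $k$-member unextendible product basis (UPB) in $\mathbb{C}^{a}\otimes\mathbb{C}^{b}$ is a family $|\phi_1\rangle,\dots,|\phi_k\rangle$ of product states with $k<ab$ and $\langle\phi_i|\phi_j\rangle=\delta_{ij}$ for all $i,j$, such that no product state is orthogonal to all of the $|\phi_i\rangle$; its missing states number is $ab-k$. Theorem 5. Let $m\geq 2$ and $n\geq 10$ be integers. Then for every integer $l$ with $4\leq l\leq 2m(n-8)$ there is a UPB in $\mathbb{C}^{2m+1}\otimes\mathbb{C}^{n}$ with missing states number $l$. -/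

import Mathlib

open scoped TensorProduct

/-- The bipartite quantum system `ℂ^a ⊗ ℂ^b`, with the Hilbert space structure in which
`⟪x ⊗ y, x' ⊗ y'⟫ = ⟪x, x'⟫ * ⟪y, y'⟫`. -/
abbrev BipartiteSystem (a b : ℕ) : Type :=
  EuclideanSpace ℂ (Fin a) ⊗[ℂ] EuclideanSpace ℂ (Fin b)

/-- A product state: a unit vector of the form `x ⊗ y`. -/
def IsProductState {a b : ℕ} (ψ : BipartiteSystem a b) : Prop :=
  ‖ψ‖ = 1 ∧ ∃ (x : EuclideanSpace ℂ (Fin a)) (y : EuclideanSpace ℂ (Fin b)), ψ = x ⊗ₜ[ℂ] y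

/-- The states `φ 0, …, φ (k - 1)` form a `k`-member unextendible product basis (UPB)
of `ℂ^a ⊗ ℂ^b`. -/
structure IsUPB {a b k : ℕ} (φ : Fin k → BipartiteSystem a b) : Prop where
  card_lt : k < a * b
  product : ∀ i, IsProductState (φ i)
  orthonormal : Orthonormal ℂ φ
  unextendible : ∀ ψ : BipartiteSystem a b, (∀ i, inner ℂ (φ i) ψ = 0) → ¬ IsProductState ψ

/-- There is a UPB in `ℂ^a ⊗ ℂ^b` with missing states number `l`, that is, a UPB with `k`
members where `a * b - k = l`. -/
def HasUPBWithMissingNumber (a b l : ℕ) : Prop :=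
  ∃ (k : ℕ) (φ : Fin k → BipartiteSystem a b), IsUPB φ ∧ k + l = a * b

/-! Missing numbers add under a splitting of the second factor: unextendible families on
complementary blocks of columns, with the same first factor, unite to an unextendible family.
Complete bases (missing number 0) serve as padding. It remains to find enough blocks.

The main block (`odd_odd`) has `2m + 1` rows, `2μ + 1` columns and the least possible size `k = 2m +
2μ + 1`, so it misses `4mμ`. Its vectors are weighted Vandermonde vectors at `k`-th roots of unity.
Any full-size subset is independent, so pigeonhole gives unextendibility. Orthogonality asks that
for each `0 < d < k` one of two positive weight polynomials vanishes at the `d`-th point. The first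
is a product of quadratics with roots at the odd `d` below the number of rows and at their negatives
mod `k`. The second must kill the remaining `d`: its weights are samples of an odd-frequency cosine
polynomial minus a constant, positive on one arc and zero on the rest
(`exists_oddCosines_pos_and_zero`).

Small tile bases missing 5, 6 or 7, next to three-column blocks missing `4j`, give every remainder
from 4 to `4m + 3` in eight columns (`eight_columns`). Division of `l` by `4m` finishes. -/

/-- There is an unextendible family of pairwise orthogonal nonzero product vectors `x s ⊗ y s` in
`ℂ^ι ⊗ ℂ^κ` with `|ι| * |κ| - l` members. For `l = 0` it may be a complete product basis. -/
def HasMissing (ι κ : Type) [Fintype ι] [Fintype κ] (l : ℕ) : Prop :=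
  ∃ (σ : Type) (_ : Fintype σ) (x : σ → ι → ℂ) (y : σ → κ → ℂ),
    Fintype.card σ + l = Fintype.card ι * Fintype.card κ ∧
    (∀ s, x s ≠ 0) ∧ (∀ s, y s ≠ 0) ∧
    (∀ s t, s ≠ t → star (x s) ⬝ᵥ x t = 0 ∨ star (y s) ⬝ᵥ y t = 0) ∧
    ∀ u v, (∀ s, star (x s) ⬝ᵥ u = 0 ∨ star (y s) ⬝ᵥ v = 0) → u = 0 ∨ v = 0

/-! ### Operations on unextendible product families -/

namespace HasMissing

variable {ι ι' κ κ' : Type} [Fintype ι] [Fintype ι'] [Fintype κ] [Fintype κ'] {l l' : ℕ}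

theorem swap (h : HasMissing ι κ l) : HasMissing κ ι l := by
  obtain ⟨σ, _, x, y, hc, hx, hy, ho, hu⟩ := h
  exact ⟨σ, inferInstance, y, x, by rw [hc, mul_comm], hy, hx, fun s t hst => (ho s t hst).symm,
    fun u v huv => (hu v u fun s => (huv s).symm).symm⟩

theorem reindex (e : κ ≃ κ') (h : HasMissing ι κ l) : HasMissing ι κ' l := by
  obtain ⟨σ, _, x, y, hc, hx, hy, ho, hu⟩ := h
  have key : ∀ (a : κ → ℂ) (b : κ' → ℂ), star (a ∘ e.symm) ⬝ᵥ b = star a ⬝ᵥ (b ∘ e) := by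
    intro a b
    simp only [dotProduct, Pi.star_apply, Function.comp_apply]
    exact Fintype.sum_equiv e.symm _ _ (by simp)
  refine ⟨σ, inferInstance, x, fun s => y s ∘ e.symm, by rw [hc, Fintype.card_congr e], hx,
    fun s hs => hy s ?_, fun s t hst => ?_, fun u v huv => ?_⟩
  · ext i
    simpa using congrFun hs (e i)
  · rw [key]
    simpa [Function.comp_assoc] using ho s t hst
  · refine (hu u (v ∘ e) fun s => by simpa [key] using huv s).imp_right fun h0 => ?_
    ext i
    simpa using congrFun h0 (e.symm i)

theorem zero (ι κ : Type) [Fintype ι] [Fintype κ] : HasMissing ι κ 0 := by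
  classical
  refine ⟨ι × κ, inferInstance, fun s => Pi.single s.1 1, fun s => Pi.single s.2 1, by simp,
    fun s => by simp, fun s => by simp, fun s t hst => ?_, fun u v huv => ?_⟩
  · by_contra! h
    simp only [Pi.star_single, star_one, single_one_dotProduct, Pi.single_apply] at h
    apply hst
    ext <;> by_contra hne <;> simp_all
  · by_contra! h
    obtain ⟨i, hi⟩ := Function.ne_iff.1 h.1
    obtain ⟨j, hj⟩ := Function.ne_iff.1 h.2
    have := huv (i, j)
    simp only [Pi.star_single, star_one, single_one_dotProduct] at this
    exact this.elim hi hj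

/-- Disjoint supports make the two families orthogonal. A nonzero `u` is tested against both
families, so each of them kills its own half of `v`. -/
theorem sum (h : HasMissing ι κ l) (h' : HasMissing ι κ' l') :
    HasMissing ι (κ ⊕ κ') (l + l') := by
  obtain ⟨σ, _, x, y, hc, hx, hy, ho, hu⟩ := h
  obtain ⟨σ', _, x', y', hc', hx', hy', ho', hu'⟩ := h'
  refine ⟨σ ⊕ σ', inferInstance, Sum.elim x x',
    Sum.elim (fun s => Sum.elim (y s) 0) (fun s => Sum.elim 0 (y' s)), ?_, ?_, ?_, ?_, ?_⟩
  · rw [Fintype.card_sum, Fintype.card_sum, mul_add, ← hc, ← hc']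
    ring
  · rintro (s | s)
    exacts [hx s, hx' s]
  · rintro (s | s) h0
    · exact hy s (funext fun i => congrFun h0 (Sum.inl i))
    · exact hy' s (funext fun i => congrFun h0 (Sum.inr i))
  · rintro (s | s) (t | t) hst
    · simpa [dotProduct] using ho s t (by simpa using hst)
    · simp [dotProduct]
    · simp [dotProduct]
    · simpa [dotProduct] using ho' s t (by simpa using hst)
  · intro u v huv
    by_contra! h
    have h1 := (hu u (v ∘ Sum.inl) fun s => by
      simpa [dotProduct] using huv (Sum.inl s)).resolve_left h.1
    have h2 := (hu' u (v ∘ Sum.inr) fun s => by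
      simpa [dotProduct] using huv (Sum.inr s)).resolve_left h.1
    refine h.2 (funext ?_)
    rintro (i | i)
    exacts [congrFun h1 i, congrFun h2 i]

theorem add {a b b' : ℕ} (h : HasMissing (Fin a) (Fin b) l) (h' : HasMissing (Fin a) (Fin b') l') :
    HasMissing (Fin a) (Fin (b + b')) (l + l') :=
  (h.sum h').reindex finSumFinEquiv

theorem mono_right {a b b' : ℕ} (hb : b ≤ b') (h : HasMissing (Fin a) (Fin b) l) :
    HasMissing (Fin a) (Fin b') l := by
  obtain ⟨c, rfl⟩ := Nat.exists_eq_add_of_le hb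
  exact h.add (zero (Fin a) (Fin c))

theorem mono {a a' b b' : ℕ} (ha : a ≤ a') (hb : b ≤ b') (h : HasMissing (Fin a) (Fin b) l) :
    HasMissing (Fin a') (Fin b') l :=
  ((h.mono_right hb).swap.mono_right ha).swap

theorem hasUPBWithMissingNumber {a b : ℕ} (h : HasMissing (Fin a) (Fin b) l) (hl : 0 < l) :
    HasUPBWithMissingNumber a b l := by
  obtain ⟨σ, _, x, y, hc, hx, hy, ho, hu⟩ := h
  simp only [Fintype.card_fin] at hc
  let e := Fintype.equivFin σ
  let X : σ → EuclideanSpace ℂ (Fin a) := fun s => WithLp.toLp 2 (x s)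
  let Y : σ → EuclideanSpace ℂ (Fin b) := fun s => WithLp.toLp 2 (y s)
  have hX : ∀ s, X s ≠ 0 := fun s h0 => hx s (by simpa [X] using h0)
  have hY : ∀ s, Y s ≠ 0 := fun s h0 => hy s (by simpa [Y] using h0)
  have hiX : ∀ s u, inner ℂ (X s) u = star (x s) ⬝ᵥ u.ofLp := fun s u => by
    rw [EuclideanSpace.inner_eq_star_dotProduct, dotProduct_comm]
  have hiY : ∀ s u, inner ℂ (Y s) u = star (y s) ⬝ᵥ u.ofLp := fun s u => by
    rw [EuclideanSpace.inner_eq_star_dotProduct, dotProduct_comm]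
  let φ : σ → BipartiteSystem a b := fun s =>
    (((‖X s‖⁻¹ : ℝ) : ℂ) • X s) ⊗ₜ[ℂ] (((‖Y s‖⁻¹ : ℝ) : ℂ) • Y s)
  have hnorm : ∀ s, ‖φ s‖ = 1 := fun s => by
    have h1 := norm_ne_zero_iff.2 (hX s)
    have h2 := norm_ne_zero_iff.2 (hY s)
    simp only [φ, TensorProduct.norm_tmul, norm_smul, Complex.norm_real, norm_inv, norm_norm]
    field_simp
  refine ⟨Fintype.card σ, φ ∘ e.symm, ⟨by omega, fun i => ⟨hnorm _, _, _, rfl⟩, ?_, ?_⟩, hc⟩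
  · refine Orthonormal.comp ⟨hnorm, fun s t hst => ?_⟩ _ e.symm.injective
    have := ho s t hst
    simp only [φ, TensorProduct.inner_tmul, inner_smul_left, inner_smul_right, hiX, hiY]
    rcases this with h | h <;> simp [X, Y, h]
  · rintro ψ hψ ⟨h1, u, v, rfl⟩
    have := hu u.ofLp v.ofLp fun s => by
      have := hψ (e s)
      simp only [φ, Function.comp_apply, Equiv.symm_apply_apply, TensorProduct.inner_tmul,
        inner_smul_left, hiX, hiY] at this
      simpa [hX, hY] using this
    rcases this with h | h
    · simp [(by simpa using h : u = 0)] at h1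
    · simp [(by simpa using h : v = 0)] at h1

/-- A criterion for families of vectors with integer coordinates. -/
theorem of_int {a b N : ℕ} (x : Fin N → Fin a → ℤ) (y : Fin N → Fin b → ℤ) (hc : N + l = a * b)
    (hx : ∀ s, x s ≠ 0) (hy : ∀ s, y s ≠ 0)
    (ho : ∀ s t, s ≠ t → x s ⬝ᵥ x t = 0 ∨ y s ⬝ᵥ y t = 0)
    (hu : ∀ (u : Fin a → ℂ) (v : Fin b → ℂ),
      (∀ s, ∑ i, (x s i : ℂ) * u i = 0 ∨ ∑ i, (y s i : ℂ) * v i = 0) → u = 0 ∨ v = 0) :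
    HasMissing (Fin a) (Fin b) l := by
  have hne : ∀ {c : ℕ} {z : Fin c → ℤ}, z ≠ 0 → (fun i => (z i : ℂ)) ≠ 0 := fun hz h0 =>
    hz (funext fun i => by simpa using congrFun h0 i)
  have hcast : ∀ {c : ℕ} {z w : Fin c → ℤ}, z ⬝ᵥ w = 0 →
      star (fun i => (z i : ℂ)) ⬝ᵥ (fun i => (w i : ℂ)) = 0 := fun {c z w} h => by
    simpa [dotProduct] using congrArg (Int.cast : ℤ → ℂ) h
  refine ⟨Fin N, inferInstance, fun s i => x s i, fun s i => y s i, by simpa using hc,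
    fun s => hne (hx s), fun s => hne (hy s), fun s t hst => (ho s t hst).imp hcast hcast,
    fun u v huv => hu u v fun s => by simpa [dotProduct] using huv s⟩

end HasMissing

/-! ### Tile bases: each tile of area `t` gives `t - 1` vectors of coordinate sum zero, and one
all-ones vector is added, so the missing number is the number of tiles minus 1 -/

namespace HasMissing

/-- A tile basis for the tiling `AABC / DEBD / FEFC` of the `3 × 4` grid by dominoes. -/
theorem three_four_five : HasMissing (Fin 3) (Fin 4) 5 := by
  refine of_int (N := 7)
    ![![1, 0, 0], ![1, -1, 0], ![1, 0, -1], ![0, 1, 0], ![0, 1, -1], ![0, 0, 1], ![1, 1, 1]]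
    ![![1, -1, 0, 0], ![0, 0, 1, 0], ![0, 0, 0, 1], ![1, 0, 0, -1], ![0, 1, 0, 0],
      ![1, 0, -1, 0], ![1, 1, 1, 1]]
    (by norm_num) (by decide) (by decide) (by decide) fun u v h => ?_
  simp only [Fin.forall_fin_succ, Fin.sum_univ_succ] at h
  simp [Fin.succ_one_eq_two] at h
  simp only [funext_iff, Fin.forall_fin_succ]
  simp
  grind

/-- A tile basis for the tiling `ABCD / EBEE / FFCF / GGGD` of the `4 × 4` grid. -/
theorem four_four_six : HasMissing (Fin 4) (Fin 4) 6 := by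
  refine of_int (N := 10)
    ![![1, -1, 0, 0], ![1, 0, -1, 0], ![1, 0, 0, -1], ![0, 1, 0, 0], ![0, 1, 0, 0], ![0, 0, 1, 0],
      ![0, 0, 1, 0], ![0, 0, 0, 1], ![0, 0, 0, 1], ![1, 1, 1, 1]]
    ![![0, 1, 0, 0], ![0, 0, 1, 0], ![0, 0, 0, 1], ![1, 0, -1, 0], ![1, 0, 1, -2], ![1, -1, 0, 0],
      ![1, 1, 0, -2], ![1, -1, 0, 0], ![1, 1, -2, 0], ![1, 1, 1, 1]]
    (by norm_num) (by decide) (by decide) (by decide) fun u v h => ?_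
  simp only [Fin.forall_fin_succ, Fin.sum_univ_succ] at h
  simp [Fin.succ_one_eq_two] at h
  simp only [funext_iff, Fin.forall_fin_succ]
  simp
  grind

/-- A tile basis for the tiling `AABC / DEBD / FGGC / FEHH` of the `4 × 4` grid by dominoes. -/
theorem four_four_seven : HasMissing (Fin 4) (Fin 4) 7 := by
  refine of_int (N := 9)
    ![![1, 0, 0, 0], ![1, -1, 0, 0], ![1, 0, -1, 0], ![0, 1, 0, 0], ![0, 1, 0, -1], ![0, 0, 1, -1],
      ![0, 0, 1, 0], ![0, 0, 0, 1], ![1, 1, 1, 1]]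
    ![![1, -1, 0, 0], ![0, 0, 1, 0], ![0, 0, 0, 1], ![1, 0, 0, -1], ![0, 1, 0, 0], ![1, 0, 0, 0],
      ![0, 1, -1, 0], ![0, 0, 1, -1], ![1, 1, 1, 1]]
    (by norm_num) (by decide) (by decide) (by decide) fun u v h => ?_
  simp only [Fin.forall_fin_succ, Fin.sum_univ_succ] at h
  simp [Fin.succ_one_eq_two] at h
  simp only [funext_iff, Fin.forall_fin_succ]
  simp
  grind

end HasMissing

/-! ### Weighted Vandermonde families -/

/-- The vector `(√(α 0), √(α 1) z, …, √(α (a - 1)) z ^ (a - 1))`. -/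
noncomputable def weightedPowers (a : ℕ) (α : ℕ → ℝ) (z : ℂ) : Fin a → ℂ :=
  fun i => (√(α i) : ℂ) * z ^ (i : ℕ)

theorem star_weightedPowers_dotProduct {a : ℕ} {α : ℕ → ℝ} (hα : ∀ t < a, 0 < α t) (z w : ℂ) :
    star (weightedPowers a α z) ⬝ᵥ weightedPowers a α w =
      ∑ t ∈ Finset.range a, (α t : ℂ) * (star z * w) ^ t := by
  rw [Finset.sum_range]
  refine Finset.sum_congr rfl fun i _ => ?_
  have h : (√(α i) : ℂ) * (√(α i) : ℂ) = α i := by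
    rw [← Complex.ofReal_mul, Real.mul_self_sqrt (hα i i.2).le]
  simp only [weightedPowers, Pi.star_apply, star_mul', star_pow, RCLike.star_def,
    Complex.conj_ofReal, mul_pow]
  rw [← h]
  ring

theorem star_weightedPowers_dotProduct_comm {a : ℕ} (α : ℕ → ℝ) (z w : ℂ) :
    star (weightedPowers a α z) ⬝ᵥ weightedPowers a α w =
      star (star (weightedPowers a α w) ⬝ᵥ weightedPowers a α z) := by
  rw [Matrix.star_dotProduct]

theorem weightedPowers_ne_zero {a : ℕ} (ha : 0 < a) {α : ℕ → ℝ} (hα : ∀ t < a, 0 < α t) (z : ℂ) :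
    weightedPowers a α z ≠ 0 := fun h => by
  have := congrFun h ⟨0, ha⟩
  simp only [weightedPowers, pow_zero, mul_one, Pi.zero_apply, Complex.ofReal_eq_zero] at this
  exact (Real.sqrt_pos.2 (hα 0 ha)).ne' this

/-- After the nonzero weights are absorbed into `u`, this is invertibility of a Vandermonde matrix
with distinct nodes. -/
theorem eq_zero_of_orthogonal_weightedPowers {a k : ℕ} {α : ℕ → ℝ} (hα : ∀ t < a, 0 < α t)
    {z : Fin k → ℂ} (hz : Function.Injective z) {u : Fin a → ℂ} (J : Finset (Fin k))
    (hJ : a ≤ J.card) (hu : ∀ s ∈ J, star (weightedPowers a α (z s)) ⬝ᵥ u = 0) : u = 0 := by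
  let e := J.orderEmbOfCardLe hJ
  have key : (fun i : Fin a => (√(α i) : ℂ) * u i) = 0 := by
    refine Matrix.eq_zero_of_forall_index_sum_pow_mul_eq_zero (f := fun j => star (z (e j)))
      (star_injective.comp (hz.comp e.injective)) fun j => ?_
    rw [← hu (e j) (J.orderEmbOfCardLe_mem hJ j)]
    refine Finset.sum_congr rfl fun i _ => ?_
    simp only [weightedPowers, Pi.star_apply, star_mul', star_pow, RCLike.star_def,
      Complex.conj_ofReal]
    ring
  funext i
  have h := congrFun key i
  have h' : (√(α i) : ℂ) ≠ 0 := by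
    simpa using (Real.sqrt_pos.2 (hα i i.2)).ne'
  simpa [h'] using h

/-- Two weighted Vandermonde families of vectors on the unit circle give an unextendible product
family of the least possible size, as soon as the orthogonality relations hold. -/
theorem HasMissing.of_weightedPowers {a b k l : ℕ} (ha : 0 < a) (hb : 0 < b) (hk : k + 1 = a + b)
    (hl : k + l = a * b) {α β : ℕ → ℝ} (hα : ∀ t < a, 0 < α t) (hβ : ∀ t < b, 0 < β t) {ζ ω : ℂ}
    (hζ : ‖ζ‖ = 1) (hω : ‖ω‖ = 1) (hζi : Function.Injective fun s : Fin k => ζ ^ (s : ℕ))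
    (hωi : Function.Injective fun s : Fin k => ω ^ (s : ℕ))
    (ho : ∀ d, 0 < d → d < k → ∑ t ∈ Finset.range a, (α t : ℂ) * (ζ ^ d) ^ t = 0 ∨
      ∑ t ∈ Finset.range b, (β t : ℂ) * (ω ^ d) ^ t = 0) :
    HasMissing (Fin a) (Fin b) l := by
  have hpow : ∀ {z : ℂ}, ‖z‖ = 1 → ∀ {s t : ℕ}, s ≤ t → star (z ^ s) * z ^ t = z ^ (t - s) := by
    intro z hz s t hst
    obtain ⟨d, rfl⟩ := Nat.exists_eq_add_of_le hst
    have h1 : star (z ^ s) * z ^ s = 1 := by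
      rw [RCLike.star_def, Complex.conj_mul', norm_pow, hz]
      simp
    rw [pow_add, ← mul_assoc, h1, one_mul, Nat.add_sub_cancel_left]
  have hlt : ∀ s t : Fin k, s < t →
      star (weightedPowers a α (ζ ^ (s : ℕ))) ⬝ᵥ weightedPowers a α (ζ ^ (t : ℕ)) = 0 ∨
      star (weightedPowers b β (ω ^ (s : ℕ))) ⬝ᵥ weightedPowers b β (ω ^ (t : ℕ)) = 0 := by
    intro s t hst
    have hst' : (s : ℕ) < t := hst
    rw [star_weightedPowers_dotProduct hα, star_weightedPowers_dotProduct hβ,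
      hpow hζ hst'.le, hpow hω hst'.le]
    exact ho _ (by omega) (by omega)
  refine ⟨Fin k, inferInstance, fun s => weightedPowers a α (ζ ^ (s : ℕ)),
    fun s => weightedPowers b β (ω ^ (s : ℕ)), by simpa using hl,
    fun s => weightedPowers_ne_zero ha hα _, fun s => weightedPowers_ne_zero hb hβ _,
    fun s t hst => ?_, fun u v huv => ?_⟩
  · rcases lt_or_gt_of_ne hst with h | h
    · exact hlt s t h
    · rw [star_weightedPowers_dotProduct_comm, star_weightedPowers_dotProduct_comm (a := b)]
      exact (hlt t s h).imp (fun h => by rw [h, star_zero]) (fun h => by rw [h, star_zero])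
  · classical
    -- Pigeonhole: if `u` is orthogonal to fewer than `a` vectors, then `v` is orthogonal to at
    -- least `k - (a - 1) = b` of them.
    let J : Finset (Fin k) := {s | star (weightedPowers a α (ζ ^ (s : ℕ))) ⬝ᵥ u = 0}
    by_cases hJ : a ≤ J.card
    · exact .inl (eq_zero_of_orthogonal_weightedPowers hα hζi J hJ fun s hs => by simpa [J] using hs)
    · refine .inr (eq_zero_of_orthogonal_weightedPowers hβ hωi Jᶜ ?_ fun s hs => ?_)
      · rw [Finset.card_compl, Fintype.card_fin]
        omega
      · exact (huv s).resolve_left (by simpa [J] using hs)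

/-! ### Trigonometric polynomials with odd frequencies -/

/-- The span of `sin x, sin 3x, …, sin (2m - 1)x`. -/
noncomputable def oddSines (m : ℕ) : Submodule ℝ (ℝ → ℝ) :=
  Submodule.span ℝ {f | ∃ i < m, f = fun x => Real.sin ((2 * i + 1 : ℕ) * x)}

/-- The span of `cos x, cos 3x, …, cos (2m - 1)x`. -/
noncomputable def oddCosines (m : ℕ) : Submodule ℝ (ℝ → ℝ) :=
  Submodule.span ℝ {f | ∃ i < m, f = fun x => Real.cos ((2 * i + 1 : ℕ) * x)}

theorem oddSines_mono {m n : ℕ} (h : m ≤ n) : oddSines m ≤ oddSines n :=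
  Submodule.span_mono fun _ ⟨i, hi, hf⟩ => ⟨i, hi.trans_le h, hf⟩

theorem sin_mem_oddSines {i m : ℕ} (h : i < m) :
    (fun x => Real.sin ((2 * i + 1 : ℕ) * x)) ∈ oddSines m :=
  Submodule.subset_span ⟨i, h, rfl⟩

theorem cos_two_mul_mem_oddSines {m : ℕ} {f : ℝ → ℝ} (hf : f ∈ oddSines m) :
    (fun x => Real.cos (2 * x) * f x) ∈ oddSines (m + 1) := by
  refine Submodule.span_induction ?_ ?_ ?_ ?_ hf
  · rintro f ⟨i, hi, rfl⟩
    have h1 := sin_mem_oddSines (Nat.succ_lt_succ hi)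
    have h2 : (fun x => Real.sin ((2 * i - 1 : ℝ) * x)) ∈ oddSines (m + 1) := by
      -- For `i = 0` the lower frequency is `-1`, and oddness of sine folds it back to `1`.
      rcases i with _ | i
      · convert (oddSines (m + 1)).neg_mem (sin_mem_oddSines (Nat.succ_pos m)) using 1
        funext x
        simp
      · convert sin_mem_oddSines (i := i) (m := m + 1) (by omega) using 4
        push_cast
        ring
    convert (oddSines (m + 1)).smul_mem (1 / 2 : ℝ) ((oddSines (m + 1)).add_mem h1 h2) using 1
    funext x
    simp only [Pi.smul_apply, Pi.add_apply, smul_eq_mul]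
    have e1 : ((2 * (i + 1) + 1 : ℕ) : ℝ) * x = (2 * i + 1 : ℕ) * x + 2 * x := by push_cast; ring
    have e2 : (2 * i - 1 : ℝ) * x = (2 * i + 1 : ℕ) * x - 2 * x := by push_cast; ring
    rw [Nat.succ_eq_add_one, e1, e2, Real.sin_add, Real.sin_sub]
    ring
  · convert (oddSines (m + 1)).zero_mem using 1
    funext x
    simp
  · intro f g _ _ h1 h2
    convert (oddSines (m + 1)).add_mem h1 h2 using 1
    funext x
    simp [mul_add]
  · intro c f _ h
    convert (oddSines (m + 1)).smul_mem c h using 1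
    funext x
    simp only [Pi.smul_apply, smul_eq_mul]
    ring

/-- A discrete antiderivative: `cos (p(x - δ)) - cos (p(x + δ)) = 2 sin (pδ) sin (px)`, so each
frequency `p` is divided by `2 sin (pδ)`. -/
theorem exists_oddCosines_sub_eq {m : ℕ} {δ : ℝ} (hδ : ∀ i < m, Real.sin ((2 * i + 1 : ℕ) * δ) ≠ 0)
    {f : ℝ → ℝ} (hf : f ∈ oddSines m) :
    ∃ K ∈ oddCosines m, ∀ x, K (x - δ) - K (x + δ) = f x := by
  refine Submodule.span_induction ?_ ⟨0, Submodule.zero_mem _, by simp⟩ ?_ ?_ hf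
  · rintro f ⟨i, hi, rfl⟩
    refine ⟨_, (oddCosines m).smul_mem (2 * Real.sin ((2 * i + 1 : ℕ) * δ))⁻¹
      (Submodule.subset_span ⟨i, hi, rfl⟩), fun x => ?_⟩
    have := hδ i hi
    simp only [Pi.smul_apply, smul_eq_mul, mul_sub, mul_add, Real.cos_sub, Real.cos_add]
    field_simp
    ring
  · rintro f g - - ⟨K, hK, h⟩ ⟨L, hL, h'⟩
    refine ⟨K + L, Submodule.add_mem _ hK hL, fun x => ?_⟩
    simp only [Pi.add_apply, ← h, ← h']
    ring
  · rintro c f - ⟨K, hK, h⟩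
    refine ⟨c • K, Submodule.smul_mem _ _ hK, fun x => ?_⟩
    simp only [Pi.smul_apply, smul_eq_mul, ← h]
    ring

theorem oddCosines_neg {m : ℕ} {K : ℝ → ℝ} (hK : K ∈ oddCosines m) (x : ℝ) : K (-x) = K x := by
  refine Submodule.span_induction (p := fun K _ => K (-x) = K x) ?_ rfl ?_ ?_ hK
  · rintro f ⟨i, -, rfl⟩
    simp
  · intro f g _ _ h h'
    simp [h, h']
  · intro c f _ h
    simp [h]

theorem oddCosines_two_pi_sub {m : ℕ} {K : ℝ → ℝ} (hK : K ∈ oddCosines m) (x : ℝ) :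
    K (2 * Real.pi - x) = K x := by
  refine Submodule.span_induction (p := fun K _ => K (2 * Real.pi - x) = K x) ?_ rfl ?_ ?_ hK
  · rintro f ⟨i, -, rfl⟩
    simp only [mul_sub]
    exact Real.cos_nat_mul_two_pi_sub _ _
  · intro f g _ _ h h'
    simp [h, h']
  · intro c f _ h
    simp [h]

theorem sum_pow_eq_zero_of_ne_one {k : ℕ} {z : ℂ} (hz : z ≠ 1) (hk : z ^ k = 1) :
    ∑ n ∈ Finset.range k, z ^ n = 0 := by
  rw [geom_sum_eq hz, hk, sub_self, zero_div]

/-- Orthogonality of characters of `ℤ/k`: each cosine splits into the frequencies `±(2i + 1)`, and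
`hne` says that neither cancels `d` modulo `k`. -/
theorem sum_oddCosines_mul_pow {m k : ℕ} (hk : k ≠ 0) (hm : 2 * m < k) {K : ℝ → ℝ}
    (hK : K ∈ oddCosines m) (c : ℝ) {d : ℕ} (hd : 0 < d) (hdk : d < k)
    (hne : ∀ i < m, d ≠ 2 * i + 1 ∧ d + (2 * i + 1) ≠ k) :
    ∑ n ∈ Finset.range k, (K (2 * (Real.pi / k) * (n - c)) : ℂ) *
      (Complex.exp (2 * Real.pi * Complex.I / k) ^ d) ^ n = 0 := by
  have hω := Complex.isPrimitiveRoot_exp k hk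
  set ω := Complex.exp (2 * Real.pi * Complex.I / k) with hωdef
  have hsum : ∀ e, e ≠ k → 0 < e → e < 2 * k → ∑ n ∈ Finset.range k, (ω ^ e) ^ n = 0 := by
    intro e h1 h2 h3
    refine sum_pow_eq_zero_of_ne_one (fun h => ?_) ?_
    · obtain ⟨q, rfl⟩ := (hω.pow_eq_one_iff_dvd e).1 h
      have : q < 2 := by nlinarith
      interval_cases q <;> simp_all
    · rw [← pow_mul, mul_comm, pow_mul, hω.pow_eq_one, one_pow]
  refine Submodule.span_induction (p := fun K _ => ∑ n ∈ Finset.range k,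
    (K (2 * (Real.pi / k) * (n - c)) : ℂ) * (ω ^ d) ^ n = 0) ?_ (by simp) ?_ ?_ hK
  · rintro f ⟨i, hi, rfl⟩
    have h1 := hsum (d + (2 * i + 1)) (hne i hi).2 (by omega) (by omega)
    have h2 := hsum (d + (k - (2 * i + 1))) (by have := (hne i hi).1; omega) (by omega) (by omega)
    have hexp : ∀ n : ℕ, ω ^ n = Complex.exp (n * (2 * Real.pi * Complex.I / k)) := fun n =>
      (Complex.exp_nat_mul _ n).symm
    have hinv : ω ^ (k - (2 * i + 1)) =
        Complex.exp (-((2 * i + 1 : ℕ) * (2 * Real.pi * Complex.I / k))) := by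
      rw [Complex.exp_neg, ← hexp, pow_sub₀ _ (hω.ne_zero hk) (by omega), hω.pow_eq_one, one_mul]
    clear_value ω
    have hterm : ∀ n : ℕ,
        ((Real.cos ((2 * i + 1 : ℕ) * (2 * (Real.pi / k) * (n - c))) : ℝ) : ℂ) * (ω ^ d) ^ n =
        Complex.exp (-(2 * i + 1 : ℕ) * (2 * (Real.pi / k) * c) * Complex.I) / 2 *
          (ω ^ (d + (2 * i + 1))) ^ n +
        Complex.exp ((2 * i + 1 : ℕ) * (2 * (Real.pi / k) * c) * Complex.I) / 2 *
          (ω ^ (d + (k - (2 * i + 1)))) ^ n := by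
      intro n
      rw [pow_add ω d (2 * i + 1), pow_add ω d (k - (2 * i + 1)), mul_pow, mul_pow, hinv, hexp (2 * i + 1), ← Complex.exp_nat_mul _ n,
        ← Complex.exp_nat_mul _ n, Complex.ofReal_cos, Complex.cos]
      have e1 : Complex.exp (((2 * i + 1 : ℕ) * (2 * (Real.pi / k) * (n - c)) : ℝ) * Complex.I) =
          Complex.exp (-(2 * i + 1 : ℕ) * (2 * (Real.pi / k) * c) * Complex.I) *
          Complex.exp (n * ((2 * i + 1 : ℕ) * (2 * Real.pi * Complex.I / k))) := by
        rw [← Complex.exp_add]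
        congr 1
        push_cast
        ring
      have e2 : Complex.exp (-((2 * i + 1 : ℕ) * (2 * (Real.pi / k) * (n - c)) : ℝ) * Complex.I) =
          Complex.exp ((2 * i + 1 : ℕ) * (2 * (Real.pi / k) * c) * Complex.I) *
          Complex.exp (n * (-((2 * i + 1 : ℕ) * (2 * Real.pi * Complex.I / k)))) := by
        rw [← Complex.exp_add]
        congr 1
        push_cast
        ring
      rw [e1, e2]
      ring
    rw [Finset.sum_congr rfl fun n _ => hterm n, Finset.sum_add_distrib, ← Finset.mul_sum,
      ← Finset.mul_sum, h1, h2]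
    ring
  · intro f g _ _ h h'
    simp only [Pi.add_apply, Complex.ofReal_add, add_mul, Finset.sum_add_distrib, h, h', add_zero]
  · intro a f _ h
    have := congrArg (fun z => (a : ℂ) * z) h
    simp only [Finset.mul_sum, mul_zero, ← mul_assoc] at this
    simpa only [Pi.smul_apply, smul_eq_mul, Complex.ofReal_mul, mul_assoc] using this

/-! ### The product of shifted sines -/

/-- The product of `sin (x + 2jδ)` over `-M ≤ j ≤ M`. -/
noncomputable def sineProduct (δ : ℝ) (M : ℕ) (x : ℝ) : ℝ :=
  Real.sin x * ∏ j ∈ Finset.range M,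
    (Real.sin (x + 2 * (j + 1 : ℕ) * δ) * Real.sin (x - 2 * (j + 1 : ℕ) * δ))

theorem sineProduct_succ (δ : ℝ) (M : ℕ) (x : ℝ) :
    sineProduct δ (M + 1) x = sineProduct δ M x *
      (Real.sin (x + 2 * (M + 1 : ℕ) * δ) * Real.sin (x - 2 * (M + 1 : ℕ) * δ)) := by
  rw [sineProduct, sineProduct, Finset.prod_range_succ, ← mul_assoc (Real.sin x)]

theorem sineProduct_mem_oddSines (δ : ℝ) (M : ℕ) : sineProduct δ M ∈ oddSines (M + 1) := by
  induction M with
  | zero =>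
    convert sin_mem_oddSines (i := 0) (m := 1) one_pos using 1
    funext x
    simp [sineProduct]
  | succ M ih =>
    -- The new pair of factors is `sin (x + c) sin (x - c) = (cos 2c - cos 2x) / 2`.
    have h1 := (oddSines (M + 2)).smul_mem (Real.cos (2 * (2 * (M + 1 : ℕ) * δ)) / 2)
      (oddSines_mono (Nat.le_succ _) ih)
    have h2 := (oddSines (M + 2)).smul_mem (1 / 2 : ℝ) (cos_two_mul_mem_oddSines ih)
    convert (oddSines (M + 2)).sub_mem h1 h2 using 1
    funext x
    rw [sineProduct_succ]
    simp only [Pi.sub_apply, Pi.smul_apply, smul_eq_mul, Real.sin_add, Real.sin_sub,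
      Real.cos_two_mul]
    have e1 := Real.sin_sq_add_cos_sq x
    have e2 := Real.sin_sq_add_cos_sq (2 * (M + 1 : ℕ) * δ)
    linear_combination sineProduct δ M x * (Real.cos (2 * (M + 1 : ℕ) * δ) ^ 2 * e1 -
      Real.cos x ^ 2 * e2)

/-- The factors are spaced by `2δ`, so a shift by `2δ` only exchanges one extreme factor for
another. This gives the ratio of consecutive differences of `K` below. -/
theorem sineProduct_sub_mul_sin (δ : ℝ) (M : ℕ) (x : ℝ) :
    sineProduct δ M (x - 2 * δ) * Real.sin (x + 2 * M * δ) =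
      sineProduct δ M x * Real.sin (x - 2 * (M + 1 : ℕ) * δ) := by
  induction M with
  | zero => simp [sineProduct, mul_comm]
  | succ M ih =>
    rw [sineProduct_succ, sineProduct_succ]
    have e1 : x - 2 * δ + 2 * (M + 1 : ℕ) * δ = x + 2 * M * δ := by push_cast; ring
    have e2 : x - 2 * δ - 2 * (M + 1 : ℕ) * δ = x - 2 * (M + 1 + 1 : ℕ) * δ := by push_cast; ring
    rw [e1, e2]
    linear_combination Real.sin (x - 2 * (M + 1 + 1 : ℕ) * δ) *
      Real.sin (x + 2 * (M + 1 : ℕ) * δ) * ih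

theorem sineProduct_pos {δ : ℝ} {M : ℕ} {x : ℝ} (hδ : 0 < δ) (h1 : 2 * M * δ < x)
    (h2 : x + 2 * M * δ < Real.pi) : 0 < sineProduct δ M x := by
  have hM : (0 : ℝ) ≤ 2 * M * δ := by positivity
  refine mul_pos (Real.sin_pos_of_pos_of_lt_pi (by linarith) (by linarith))
    (Finset.prod_pos fun j hj => ?_)
  have hj' : ((j + 1 : ℕ) : ℝ) ≤ M := by exact_mod_cast Finset.mem_range.1 hj
  have hj2 : 2 * ((j + 1 : ℕ) : ℝ) * δ ≤ 2 * M * δ := by gcongr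
  have hj3 : 0 ≤ 2 * ((j + 1 : ℕ) : ℝ) * δ := by positivity
  exact mul_pos (Real.sin_pos_of_pos_of_lt_pi (by linarith) (by linarith))
    (Real.sin_pos_of_pos_of_lt_pi (by linarith) (by linarith))

theorem sineProduct_pi_sub (δ : ℝ) {M j : ℕ} (hj : j ≤ M) :
    sineProduct δ M (Real.pi - 2 * j * δ) = 0 := by
  rcases j with _ | j
  · simp [sineProduct]
  · rw [sineProduct, Finset.prod_eq_zero (Finset.mem_range.2 hj) (by simp), mul_zero]

theorem alternating_sum_nonneg {S D ρ : ℕ → ℝ} {N : ℕ} (h0 : S 0 = D 0) (hD : 0 ≤ D 0)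
    (hS : ∀ i < N, S (i + 1) = S i + D (i + 1)) (hρ : ∀ i < N, D (i + 1) = -ρ i * D i)
    (hρ0 : ∀ i < N, 0 ≤ ρ i) (hρ1 : ∀ i < N, ρ i ≤ 1) : ∀ i ≤ N, 0 ≤ S i := by
  -- The bound `D i ≤ S i` makes the induction close: subtracting `ρ i * D i` with `0 ≤ ρ i ≤ 1`
  -- cannot make the sum negative.
  suffices ∀ i ≤ N, 0 ≤ S i ∧ D i ≤ S i from fun i hi => (this i hi).1
  intro i
  induction i with
  | zero => intro _; rw [h0]; exact ⟨hD, le_rfl⟩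
  | succ i ih =>
    intro hi
    obtain ⟨h1, h2⟩ := ih (by omega)
    rw [hS i hi]
    refine ⟨?_, by linarith⟩
    rw [hρ i hi]
    nlinarith [hρ0 i hi, hρ1 i hi]

/-- A nonnegative even trigonometric polynomial on the `k`-th roots of unity, `k = 2m + 2m' + 1`,
with frequencies `0, ±1, ±3, …, ±(2m - 1)`, whose zeros are the `2m` consecutive points farthest
from `0`. -/
theorem exists_oddCosines_pos_and_zero {m m' : ℕ} (hm : 0 < m) (hmm : m ≤ m') {δ : ℝ}
    (hδ : (2 * m + 2 * m' + 1 : ℕ) * δ = Real.pi) :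
    ∃ K ∈ oddCosines m, ∃ C : ℝ, (∀ n < 2 * m' + 1, 0 < K (2 * δ * (n - m')) - C) ∧
      ∀ n, 2 * m' + 1 ≤ n → n < 2 * m + 2 * m' + 1 → K (2 * δ * (n - m')) - C = 0 := by
  have hδ0 : 0 < δ := by
    by_contra! h
    have := mul_nonpos_of_nonneg_of_nonpos (Nat.cast_nonneg (α := ℝ) (2 * m + 2 * m' + 1)) h
    linarith [Real.pi_pos]
  have hmR : (m : ℝ) ≤ m' := by exact_mod_cast hmm
  have hm1 : (1 : ℝ) ≤ m := by exact_mod_cast hm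
  push_cast at hδ
  obtain ⟨M, rfl⟩ := Nat.exists_eq_add_of_lt hm
  simp only [zero_add] at *
  push_cast at hmR hm1 hδ
  have hsin : ∀ i < M + 1, Real.sin ((2 * i + 1 : ℕ) * δ) ≠ 0 := by
    intro i hi
    have hi' : (i : ℝ) ≤ M := by exact_mod_cast Nat.lt_succ_iff.1 hi
    refine (Real.sin_pos_of_pos_of_lt_pi (by positivity) ?_).ne'
    rw [← hδ]
    push_cast
    gcongr
    linarith
  -- `K` is prescribed through its differences, which are chosen to vanish at the midpoints between
  -- the `2m` points where `K` has to be constant.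
  obtain ⟨K, hK, hKd⟩ := exists_oddCosines_sub_eq hsin (sineProduct_mem_oddSines δ M)
  have hstep : ∀ τ : ℕ, K (2 * δ * τ) - K (2 * δ * (τ + 1 : ℕ)) =
      sineProduct δ M ((2 * τ + 1) * δ) := by
    intro τ
    rw [← hKd]
    congr 2
    · ring
    · push_cast; ring
  have hzero : ∀ i ≤ M, K (2 * δ * (m' + 1 + i : ℕ)) = K (2 * δ * (m' + 1 : ℕ)) := by
    intro i
    induction i with
    | zero => simp
    | succ i ih =>
      intro hi
      rw [← ih (by omega)]
      have h := hstep (m' + 1 + i)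
      have e : (2 * (m' + 1 + i : ℕ) + 1) * δ = Real.pi - 2 * (M - i : ℕ) * δ := by
        rw [← hδ, Nat.cast_sub (by omega)]
        push_cast
        ring
      rw [e, sineProduct_pi_sub δ (Nat.sub_le _ _)] at h
      rw [← add_assoc]
      linarith
  have hpos : ∀ τ, M ≤ τ → τ ≤ m' → K (2 * δ * (τ + 1 : ℕ)) < K (2 * δ * τ) := by
    intro τ h1 h2
    have h1' : (M : ℝ) ≤ τ := by exact_mod_cast h1
    have h2' : (τ : ℝ) ≤ m' := by exact_mod_cast h2
    have := sineProduct_pos (M := M) (x := (2 * τ + 1) * δ) hδ0 (by nlinarith) (by nlinarith)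
    linarith [hstep τ]
  have hbig : ∀ i τ, τ + i = m' → M ≤ τ → K (2 * δ * (m' + 1 : ℕ)) < K (2 * δ * τ) := by
    intro i
    induction i with
    | zero =>
      rintro τ rfl h
      simpa using hpos τ h le_rfl
    | succ i ih =>
      intro τ h1 h2
      exact (ih (τ + 1) (by omega) (by omega)).trans (hpos τ h2 (by omega))
  -- Towards `0` the differences alternate in sign, with magnitudes that do not grow, so `K` stays
  -- at least its value at index `M + 1`.
  have hsmall : ∀ i ≤ M, 0 ≤ K (2 * δ * (M - i : ℕ)) - K (2 * δ * (M + 1 : ℕ)) := by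
    refine alternating_sum_nonneg (D := fun i => sineProduct δ M ((2 * (M - i : ℕ) + 1) * δ))
      (ρ := fun i => Real.sin ((2 * i + 1 : ℕ) * δ) /
        Real.sin ((2 * (M - i : ℕ) + 1 + 2 * M) * δ)) ?_ ?_ ?_ ?_ ?_ ?_
    · simpa using hstep M
    · have := hstep M
      have := hpos M le_rfl (by omega)
      simp only [Nat.sub_zero]
      linarith
    · intro i hi
      have := hstep (M - (i + 1))
      rw [show M - (i + 1) + 1 = M - i by omega] at this
      linarith
    all_goals
      intro i hi
      have hi' : (i : ℝ) + 1 ≤ M := by exact_mod_cast hi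
      have hi0 : (0 : ℝ) ≤ i := Nat.cast_nonneg _
      have hc : ((M - i : ℕ) : ℝ) = M - i := Nat.cast_sub hi.le
      have hA : 0 < Real.sin ((2 * (M - i : ℕ) + 1 + 2 * M) * δ) := by
        rw [hc]
        exact Real.sin_pos_of_pos_of_lt_pi (mul_pos (by linarith) hδ0)
          (by rw [← hδ]; exact mul_lt_mul_of_pos_right (by linarith) hδ0)
    · have h := sineProduct_sub_mul_sin δ M ((2 * (M - i : ℕ) + 1) * δ)
      have e1 : (2 * ((M - i : ℕ) : ℝ) + 1) * δ - 2 * δ = (2 * (M - (i + 1) : ℕ) + 1) * δ := by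
        rw [hc, Nat.cast_sub (by omega)]
        push_cast
        ring
      have e2 : (2 * ((M - i : ℕ) : ℝ) + 1) * δ + 2 * M * δ = (2 * (M - i : ℕ) + 1 + 2 * M) * δ := by
        ring
      have e3 : (2 * ((M - i : ℕ) : ℝ) + 1) * δ - 2 * (M + 1 : ℕ) * δ = -((2 * i + 1 : ℕ) * δ) := by
        rw [hc]
        push_cast
        ring
      rw [e1, e2, e3, Real.sin_neg] at h
      rw [neg_mul, div_mul_eq_mul_div, ← neg_div, eq_div_iff hA.ne']
      linarith
    · refine div_nonneg (Real.sin_nonneg_of_nonneg_of_le_pi (by positivity) ?_) hA.le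
      rw [← hδ]
      push_cast
      gcongr
      linarith
    -- The difference of sines is `2 sin (2(M - i)δ) cos ((2M + 1)δ)`, and both angles are at most
    -- `π / 2` because `m ≤ m'`.
    · rw [div_le_one hA, ← sub_nonneg, Real.sin_sub_sin, hc]
      push_cast
      refine mul_nonneg (mul_nonneg two_pos.le (Real.sin_nonneg_of_nonneg_of_le_pi ?_ ?_))
        (Real.cos_nonneg_of_neg_pi_div_two_le_of_le ?_ ?_)
      all_goals nlinarith [Real.pi_pos]
  have hall : ∀ τ : ℕ, τ ≤ m' → K (2 * δ * (m' + 1 : ℕ)) < K (2 * δ * τ) := by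
    intro τ hτ
    rcases le_total M τ with h | h
    · exact hbig (m' - τ) τ (by omega) h
    · have h1 := hsmall (M - τ) (by omega)
      rw [show M - (M - τ) = τ by omega] at h1
      have h2 := hbig (m' - (M + 1)) (M + 1) (by omega) (by omega)
      linarith
  refine ⟨K, hK, K (2 * δ * (m' + 1 : ℕ)), fun n hn => sub_pos.2 ?_, fun n h1 h2 => sub_eq_zero.2 ?_⟩
  · rcases le_total m' n with h | h
    · simpa [Nat.cast_sub h] using hall (n - m') (by omega)
    · rw [← oddCosines_neg hK (2 * δ * (n - m'))]
      convert hall (m' - n) (by omega) using 2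
      rw [Nat.cast_sub h]
      ring
  · by_cases h : n ≤ 2 * m' + 1 + M
    · rw [← hzero (n - (2 * m' + 1)) (by omega)]
      congr 2
      rw [Nat.cast_add, Nat.cast_sub h1]
      push_cast
      ring
    -- The other half of the zeros is the mirror image under `x ↦ 2π - x`.
    · rw [← oddCosines_two_pi_sub hK, ← hzero (2 * M + 2 * m' + 2 - n) (by omega)]
      congr 1
      rw [Nat.cast_add, Nat.cast_sub (by omega), ← hδ]
      push_cast
      ring

/-! ### Unextendible product bases of minimal size in odd dimensions -/

open Polynomial in
/-- The product of the polynomials `X ^ 2 + 2 cos ((2i + 1)δ) X + 1` over `i < m`. -/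
noncomputable def oddCosineProduct (δ : ℝ) (m : ℕ) : ℝ[X] :=
  ∏ i ∈ Finset.range m, (X ^ 2 + C (2 * Real.cos ((2 * i + 1 : ℕ) * δ)) * X + 1)

open Polynomial in
theorem oddCosineProduct_coeff {δ : ℝ} {m : ℕ}
    (h : ∀ i < m, 0 < Real.cos ((2 * i + 1 : ℕ) * δ)) :
    (oddCosineProduct δ m).natDegree < 2 * m + 1 ∧
      ∀ t < 2 * m + 1, 0 < (oddCosineProduct δ m).coeff t := by
  -- Nonnegativity of all coefficients is carried along, since the recursion also reads those beyond
  -- the degree.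
  suffices (oddCosineProduct δ m).natDegree < 2 * m + 1 ∧
      (∀ t < 2 * m + 1, 0 < (oddCosineProduct δ m).coeff t) ∧
      ∀ t, 0 ≤ (oddCosineProduct δ m).coeff t from ⟨this.1, this.2.1⟩
  induction m with
  | zero =>
    simp only [oddCosineProduct, Finset.range_zero, Finset.prod_empty, natDegree_one]
    refine ⟨by omega, fun t ht => ?_, fun t => ?_⟩
    · obtain rfl : t = 0 := by omega
      simp
    · rw [coeff_one]
      split_ifs <;> norm_num
  | succ m ih =>
    obtain ⟨h1, h2, h3⟩ := ih fun i hi => h i (by omega)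
    have hc := h m (by omega)
    set P := oddCosineProduct δ m
    set c := Real.cos ((2 * m + 1 : ℕ) * δ)
    have hs : oddCosineProduct δ (m + 1) = P * X ^ 2 + C (2 * c) * (P * X) + P := by
      rw [oddCosineProduct, Finset.prod_range_succ, ← oddCosineProduct]
      ring
    have hc0 : (oddCosineProduct δ (m + 1)).coeff 0 = P.coeff 0 := by
      rw [hs]
      simp [mul_coeff_zero]
    have hc1 : (oddCosineProduct δ (m + 1)).coeff 1 = 2 * c * P.coeff 0 + P.coeff 1 := by
      rw [hs, coeff_add, coeff_add, coeff_C_mul, coeff_mul_X, coeff_mul_X_pow']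
      simp
    have hc2 : ∀ t, (oddCosineProduct δ (m + 1)).coeff (t + 2) =
        P.coeff t + 2 * c * P.coeff (t + 1) + P.coeff (t + 2) := fun t => by
      rw [hs, coeff_add, coeff_add, coeff_C_mul, coeff_mul_X, coeff_mul_X_pow]
    refine ⟨?_, ?_, ?_⟩
    · rw [Nat.lt_succ_iff, natDegree_le_iff_coeff_eq_zero]
      intro t ht
      obtain ⟨t, rfl⟩ := Nat.exists_eq_add_of_le' (show 2 ≤ t by omega)
      rw [hc2, coeff_eq_zero_of_natDegree_lt (by omega : P.natDegree < t),
        coeff_eq_zero_of_natDegree_lt (by omega : P.natDegree < t + 1),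
        coeff_eq_zero_of_natDegree_lt (by omega : P.natDegree < t + 2)]
      ring
    · rintro (_ | _ | t) ht
      · rw [hc0]; exact h2 0 (by omega)
      · rw [hc1]; nlinarith [h2 0 (by omega), h3 1]
      · rw [hc2]
        have := mul_nonneg hc.le (h3 (t + 1))
        linarith [h2 t (by omega), h3 (t + 2)]
    · rintro (_ | _ | t)
      · rw [hc0]; exact h3 0
      · rw [hc1]
        have := mul_nonneg hc.le (h3 0)
        linarith [h3 1]
      · rw [hc2]
        have := mul_nonneg hc.le (h3 (t + 1))
        linarith [h3 t, h3 (t + 2)]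

theorem sum_oddCosineProduct_coeff {δ : ℝ} {m : ℕ}
    (h : ∀ i < m, 0 < Real.cos ((2 * i + 1 : ℕ) * δ)) (z : ℂ) :
    ∑ t ∈ Finset.range (2 * m + 1), ((oddCosineProduct δ m).coeff t : ℂ) * z ^ t =
      ∏ i ∈ Finset.range m, (z ^ 2 + 2 * Real.cos ((2 * i + 1 : ℕ) * δ) * z + 1) := by
  have := Polynomial.eval₂_eq_sum_range' Complex.ofRealHom (oddCosineProduct_coeff h).1 z
  simp only [Complex.ofRealHom_eq_coe] at this
  rw [← this, oddCosineProduct, Polynomial.eval₂_finsetProd]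
  simp [Polynomial.eval₂_mul]

theorem quadratic_exp_eq_zero (θ : ℝ) :
    (-Complex.exp (θ * Complex.I)) ^ 2 + 2 * Real.cos θ * -Complex.exp (θ * Complex.I) + 1 = 0 := by
  have h : Complex.exp (θ * Complex.I) * Complex.exp (-θ * Complex.I) = 1 := by
    rw [← Complex.exp_add]
    simp
  rw [Complex.ofReal_cos, Complex.cos]
  linear_combination -h

namespace HasMissing

theorem odd_odd_of_le {m m' : ℕ} (hm : 0 < m) (hmm : m ≤ m') :
    HasMissing (Fin (2 * m + 1)) (Fin (2 * m' + 1)) (4 * m * m') := by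
  set k := 2 * m + 2 * m' + 1 with hk
  have hk0 : k ≠ 0 := by omega
  have hkR : (k : ℝ) ≠ 0 := by exact_mod_cast hk0
  set δ : ℝ := Real.pi / k with hδdef
  have hδ : (k : ℝ) * δ = Real.pi := by rw [hδdef]; field_simp
  have hδ0 : 0 < δ := by
    rw [hδdef]
    have := Real.pi_pos
    positivity
  obtain ⟨K, hK, C, hpos, hzero⟩ := exists_oddCosines_pos_and_zero hm hmm hδ
  have hcos : ∀ i < m, 0 < Real.cos ((2 * i + 1 : ℕ) * δ) := by
    intro i hi
    have hlt : (2 * (2 * i + 1 : ℕ) : ℝ) < k := by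
      exact_mod_cast (show 2 * (2 * i + 1) < k by omega)
    have hpos : (0 : ℝ) ≤ (2 * i + 1 : ℕ) * δ := by positivity
    refine Real.cos_pos_of_mem_Ioo ⟨by linarith [Real.pi_pos], ?_⟩
    rw [← hδ]
    nlinarith
  -- With this sign `ζ ^ k = 1` (as `k` is odd) and `ζ ^ 2 = ω`, while the odd powers `ζ ^ (2i + 1)`
  -- are roots of the quadratic factors.
  set ζ : ℂ := -Complex.exp (δ * Complex.I) with hζdef
  have hω := Complex.isPrimitiveRoot_exp k hk0
  set ω := Complex.exp (2 * Real.pi * Complex.I / k) with hωdef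
  have hζω : ζ ^ 2 = ω := by
    rw [hζdef, neg_sq, ← Complex.exp_nat_mul, hωdef, hδdef]
    congr 1
    push_cast
    ring
  have hζodd : ∀ i : ℕ, ζ ^ (2 * i + 1) = -Complex.exp (((2 * i + 1 : ℕ) * δ : ℝ) * Complex.I) := by
    intro i
    rw [hζdef, Odd.neg_pow ⟨i, rfl⟩, ← Complex.exp_nat_mul]
    congr 2
    push_cast
    ring
  have hζk : ζ ^ k = 1 := by
    rw [hk, show 2 * m + 2 * m' + 1 = 2 * (m + m') + 1 by ring, hζodd,
      show 2 * (m + m') + 1 = k by rw [hk]; ring, hδ, Complex.exp_pi_mul_I, neg_neg]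
  have hωi : Function.Injective fun s : Fin k => ω ^ (s : ℕ) := fun s t h =>
    Fin.ext (hω.pow_inj s.2 t.2 h)
  refine of_weightedPowers (k := k) (α := fun t => (oddCosineProduct δ m).coeff t)
    (β := fun n => K (2 * δ * (n - m')) - C) (ζ := ζ) (ω := ω) (by omega) (by omega) (by omega) ?_
    (oddCosineProduct_coeff hcos).2 hpos ?_ ?_ (fun s t h => hωi ?_) hωi fun d hd hdk => ?_
  · rw [hk]; ring
  · rw [hζdef, norm_neg, Complex.norm_exp_ofReal_mul_I]
  · exact Complex.norm_eq_one_of_pow_eq_one hω.pow_eq_one hk0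
  · have h' : (ζ ^ (s : ℕ)) ^ 2 = (ζ ^ (t : ℕ)) ^ 2 := congrArg (· ^ 2) h
    have e : ∀ n : ℕ, (ζ ^ n) ^ 2 = ω ^ n := fun n => by rw [← pow_mul, mul_comm, pow_mul, hζω]
    simpa only [e] using h'
  · by_cases hne : ∀ i < m, d ≠ 2 * i + 1 ∧ d + (2 * i + 1) ≠ k
    · right
      have h1 := sum_oddCosines_mul_pow hk0 (by omega) hK m' hd hdk hne
      rw [← hωdef] at h1
      have h2 : ∑ n ∈ Finset.range k, (ω ^ d) ^ n = 0 := by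
        refine sum_pow_eq_zero_of_ne_one (hω.pow_ne_one_of_pos_of_lt hd.ne' hdk) ?_
        rw [← pow_mul, mul_comm, pow_mul, hω.pow_eq_one, one_pow]
      have h3 : ∑ n ∈ Finset.range k,
          ((K (2 * δ * (n - m')) - C : ℝ) : ℂ) * (ω ^ d) ^ n = 0 := by
        simp only [Complex.ofReal_sub, sub_mul, Finset.sum_sub_distrib, ← Finset.mul_sum, h2,
          mul_zero, sub_zero]
        exact_mod_cast h1
      rw [← h3]
      -- The weights vanish at the last `2m` indices, so the sum over all `k` indices reduces to the
      -- first `2m' + 1`.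
      refine Finset.sum_subset (Finset.range_mono (by omega)) fun n hn hn' => ?_
      simp only [Finset.mem_range, not_lt] at hn hn'
      rw [hzero n hn' hn]
      simp
    · left
      push Not at hne
      obtain ⟨i, hi, h⟩ := hne
      rw [sum_oddCosineProduct_coeff hcos]
      refine Finset.prod_eq_zero (Finset.mem_range.2 hi) ?_
      by_cases hd' : d = 2 * i + 1
      · rw [hd', hζodd]
        exact quadratic_exp_eq_zero _
      · have hζ' : ζ ^ d = -Complex.exp ((-((2 * i + 1 : ℕ) * δ) : ℝ) * Complex.I) := by
          have h1 : ζ ^ d * ζ ^ (2 * i + 1) = 1 := by rw [← pow_add, h hd', hζk]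
          rw [eq_inv_of_mul_eq_one_left h1, hζodd, Complex.ofReal_neg, neg_mul, Complex.exp_neg,
            inv_neg]
        rw [hζ', ← Real.cos_neg]
        exact quadratic_exp_eq_zero _

/-- The unextendible product bases of minimal size `a + b - 1` for odd `a`, `b`; when `a = 1` or
`b = 1` this is a complete basis. -/
theorem odd_odd (m m' : ℕ) : HasMissing (Fin (2 * m + 1)) (Fin (2 * m' + 1)) (4 * m * m') := by
  rcases Nat.eq_zero_or_pos m with rfl | hm
  · simpa using zero _ _
  rcases Nat.eq_zero_or_pos m' with rfl | hm'
  · simpa using zero _ _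
  rcases le_total m m' with h | h
  · exact odd_odd_of_le hm h
  · rw [show 4 * m * m' = 4 * m' * m by ring]
    exact (odd_odd_of_le hm' h).swap

/-- Five columns fix the residue of `r` mod 4 by missing 0, 5, 6 or 7; the other three contribute
the multiple `4j` with `j ≤ m`. -/
theorem eight_columns {m r : ℕ} (hm : 2 ≤ m) (hr : 4 ≤ r) (hr' : r ≤ 4 * m + 3) :
    HasMissing (Fin (2 * m + 1)) (Fin 8) r := by
  have hsmall : ∀ s j, HasMissing (Fin (2 * m + 1)) (Fin 5) s → j ≤ m →
      HasMissing (Fin (2 * m + 1)) (Fin 8) (s + 4 * j) := fun s j h hj => by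
    have := (odd_odd j 1).mono (a' := 2 * m + 1) (by omega) le_rfl
    simpa using h.add this
  have h4 : r % 4 < 4 := Nat.mod_lt _ (by norm_num)
  obtain h | h | h | h : r % 4 = 0 ∨ r % 4 = 1 ∨ r % 4 = 2 ∨ r % 4 = 3 := by omega
  · convert hsmall 0 (r / 4) (zero _ _) (by omega) using 1
    omega
  · convert hsmall 5 (r / 4 - 1) (three_four_five.mono (by omega) (by omega)) (by omega) using 1
    omega
  · convert hsmall 6 (r / 4 - 1) (four_four_six.mono (by omega) (by omega)) (by omega) using 1
    omega
  · convert hsmall 7 (r / 4 - 1) (four_four_seven.mono (by omega) (by omega)) (by omega) using 1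
    omega

end HasMissing

theorem theorem5 (m n : ℕ) (hm : 2 ≤ m) (hn : 10 ≤ n) (l : ℕ) (hl : 4 ≤ l)
    (hl' : l ≤ 2 * m * (n - 8)) : HasUPBWithMissingNumber (2 * m + 1) n l := by
  refine HasMissing.hasUPBWithMissingNumber ?_ (by omega)
  have hlarge : ∀ μ r, l = 4 * m * μ + r → 4 ≤ r → r ≤ 4 * m + 3 → 2 * μ + 9 ≤ n →
      HasMissing (Fin (2 * m + 1)) (Fin n) l := by
    rintro μ r h h1 h2 h3
    rw [h]
    exact ((HasMissing.odd_odd m μ).add (HasMissing.eight_columns hm h1 h2)).mono_right (by omega)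
  obtain ⟨μ, r, h, hr⟩ : ∃ μ r, l = 4 * m * μ + r ∧ r < 4 * m :=
    ⟨l / (4 * m), l % (4 * m), (Nat.div_add_mod _ _).symm, Nat.mod_lt _ (by omega)⟩
  have hμ : 2 * m * (2 * μ) + r ≤ 2 * m * (n - 8) := by
    rw [show 2 * m * (2 * μ) = 4 * m * μ by ring, ← h]
    exact hl'
  have hle : 2 * μ ≤ n - 8 := Nat.le_of_mul_le_mul_left (by omega) (show 0 < 2 * m by omega)
  -- A nonzero remainder makes this strict, leaving room for the `2μ + 1` columns and eight more.
  have hlt : 0 < r → 2 * μ < n - 8 := fun hr0 =>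
    Nat.lt_of_mul_lt_mul_left (a := 2 * m) (by omega)
  rcases Nat.eq_zero_or_pos r with rfl | hr0
  · rw [h]
    exact (HasMissing.odd_odd m μ).mono_right (by omega)
  have := hlt hr0
  by_cases hr4 : 4 ≤ r
  · exact hlarge μ r h hr4 (by omega) (by omega)
  -- Remainders 1, 2, 3 are too small for the eight columns, so one `4m` is borrowed; `l ≥ 4` rules
  -- out `μ = 0`.
  · rcases μ with _ | μ
    · omega
    · exact hlarge μ (4 * m + r) (by rw [h]; ring) (by omega) (by omega) (by omega)
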